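/- For a unital complex Banach algebra $\mathfrak A$, an element $e\in\mathfrak A$ is called Hermitian if $\|\exp(ite)\|=1$ for every $t\in\mathbb R$. A bounded operator $T$ on a complex Banach space $E$ is called Hermitian if it is a Hermitian element of the Banach algebra of all bounded operators on $E$. Let $X$ be a compact Hausdorff space and let $B$ be a unital point separating subalgebra of $C(X)$ (complex valued continuous functions) equipped with a Banach algebra norm. We call $B$ natural if $x\mapsto\phi_x$, $\phi_x(f)=f(x)$, is a bijection from $X$ onto the maximal ideal space of $B$, and self-adjoint if it is natural and closed under complex conjugation. Let $X,Y$ be compact Hausdorff spaces, let $B\subset C(X)$ and $\widetilde B\subset C(X\times Y)$ be unital point separating self-adjoint subalgebras, equipped with Banach algebra norms $\|\cdot\|_B$ and $\|\cdot\|_{\widetilde B}$, such that $B\otimes C(Y)\subset\widetilde B$, where $B\otimes C(Y)$ is the linear span of the functions $(f\otimes g)(x,y)=f(x)g(y)$ with $f\in B$, $g\in C(Y)$. Suppose that $\widetilde B$ is a natural $C(Y)$-valuezation of $B$, i.e. there are a compact Hausdorff space $\mathfrak M$ and a complex-linear map $D:\widetilde B\to C(\mathfrak M)$ such that $\ker D=1\otimes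 C(Y)=\{1\otimes g: g\in C(Y)\}$, $D$ maps real valued functions in $\widetilde B$ to real valued functions, and $$\|F\|_{\widetilde B}=\|F\|_{\infty(X\times Y)}+\|D(F)\|_{\infty(\mathfrak M)},\qquad F\in\widetilde B.$$ Proposition 7.3. A bounded (complex-linear) operator $T$ on $\widetilde B$ is a Hermitian operator if and only if $T(1)$ is a Hermitian element of $\widetilde B$ and $T=M_{T(1)}$, where $M_{T(1)}$ is the operator $F\mapsto T(1)F$ of multiplication by $T(1)$. -/

import Mathlib

universe u v w u₁ u₂

section HermitianElements

/-- An element `e` of a unital (complex) Banach algebra is Hermitian if `‖exp (i t e)‖ = 1` for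
every real `t`. -/
def IsHermitianElement {A : Type*} [NormedRing A] [NormedAlgebra ℂ A] (e : A) : Prop :=
  ∀ t : ℝ, ‖NormedSpace.exp ((Complex.I * (t : ℂ)) • e)‖ = 1

/-- A bounded operator on a complex Banach space `E` is Hermitian if it is a Hermitian element of
the Banach algebra of all bounded operators on `E` (with the operator norm). -/
def IsHermitianOperator {E : Type*} [NormedAddCommGroup E] [NormedSpace ℂ E]
    (T : E →L[ℂ] E) : Prop :=
  IsHermitianElement T

end HermitianElements

section FunctionAlgebras

variable {X : Type u} [TopologicalSpace X] [CompactSpace X] [T2Space X]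
variable {B : Type u₁} [NormedCommRing B] [NormedAlgebra ℂ B] [CompleteSpace B]

/-- A Banach algebra `B` is presented as a unital subalgebra of `C(X)` with its own complete
algebra norm (unrelated a priori to the supremum norm) by its inclusion `ι`, a unital algebra
homomorphism into `C(X)`. This says that `ι` identifies `B` with a point separating unital
subalgebra of `C(X)`. -/
structure IsPointSeparatingSubalgebra (ι : B →ₐ[ℂ] C(X, ℂ)) : Prop where
  injective : Function.Injective ι
  separates : ι.range.SeparatesPoints

/-- The point evaluation `φ_x : f ↦ f x`, as an element of the maximal ideal space `M_B`
(the space of characters of `B`). -/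
noncomputable def evalCharacter (ι : B →ₐ[ℂ] C(X, ℂ)) (x : X) :
    WeakDual.characterSpace ℂ B :=
  WeakDual.CharacterSpace.equivAlgHom.symm ((ContinuousMap.evalAlgHom ℂ ℂ x).comp ι)

/-- `B` is natural if `x ↦ φ_x` is a bijection from `X` onto the maximal ideal space of `B`. -/
def IsNaturalAlgebra (ι : B →ₐ[ℂ] C(X, ℂ)) : Prop :=
  Function.Bijective (evalCharacter ι)

/-- `B` is self-adjoint if it is natural and closed under complex conjugation. -/
structure IsSelfAdjointAlgebra (ι : B →ₐ[ℂ] C(X, ℂ)) : Prop where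
  natural : IsNaturalAlgebra ι
  conj_mem : ∀ f : B, star (ι f) ∈ ι.range

end FunctionAlgebras

section Valuezations

variable {X : Type u} [TopologicalSpace X] [CompactSpace X] [T2Space X]
variable {Y : Type v} [TopologicalSpace Y] [CompactSpace Y] [T2Space Y]

/-- The function `(f ⊗ g)(x, y) = f x * g y` on `X × Y`. -/
noncomputable def tensorFun (f : C(X, ℂ)) (g : C(Y, ℂ)) : C(X × Y, ℂ) where
  toFun p := f p.1 * g p.2

/-- `E ⊗ E'`: the space of all finite sums of functions `f ⊗ g`, `f ∈ E`, `g ∈ E'`. -/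
noncomputable def tensorSpace (E : Submodule ℂ C(X, ℂ)) (E' : Submodule ℂ C(Y, ℂ)) :
    Submodule ℂ C(X × Y, ℂ) :=
  Submodule.span ℂ {h | ∃ f ∈ E, ∃ g ∈ E', h = tensorFun f g}

variable {B : Type u₁} [NormedCommRing B] [NormedAlgebra ℂ B] [CompleteSpace B]
variable {Bt : Type u₂} [NormedCommRing Bt] [NormedAlgebra ℂ Bt] [CompleteSpace Bt]

/-- `Bt ⊆ C(X × Y)` (with inclusion `κ`) is a natural `C(Y)`-valuezation of `B ⊆ C(X)`
(with inclusion `ι`). -/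
structure IsNaturalValuezation (ι : B →ₐ[ℂ] C(X, ℂ)) (κ : Bt →ₐ[ℂ] C(X × Y, ℂ)) : Prop where
  base_subalgebra : IsPointSeparatingSubalgebra ι
  base_selfAdjoint : IsSelfAdjointAlgebra ι
  subalgebra : IsPointSeparatingSubalgebra κ
  selfAdjoint : IsSelfAdjointAlgebra κ
  tensor_le : tensorSpace (Subalgebra.toSubmodule ι.range) (⊤ : Submodule ℂ C(Y, ℂ)) ≤
    Subalgebra.toSubmodule κ.range
  exists_map : ∃ (M : Type w) (_ : TopologicalSpace M) (_ : CompactSpace M) (_ : T2Space M)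
    (D : Bt →ₗ[ℂ] C(M, ℂ)),
      (∀ F : Bt, F ∈ LinearMap.ker D ↔ ∃ g : C(Y, ℂ), κ F = tensorFun 1 g) ∧
      (∀ F : Bt, (∀ p, (κ F p).im = 0) → ∀ m, (D F m).im = 0) ∧
      (∀ F : Bt, ‖F‖ = ‖κ F‖ + ‖D F‖)

end Valuezations

/-! The norm ‖F‖∞ + ‖D F‖∞ has support functionals F ↦ α F(p) + ψ(D F), and a Hermitian operator
takes real values on them. At 1, where D vanishes, ψ is arbitrary, so T 1 is real and D (T 1) = 0.
Thus T 1 = 1 ⊗ g with g real, and multiplication by T 1 is Hermitian. Let S be the difference of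
these two operators, so S 1 = 0. Adding imaginary constants to a real F shows that S F vanishes
wherever |F| peaks (`sub_apply_sq_eq_zero` is then obtained from peaking functions N - (F - F(p))²:
S (F²) = 2 F S F). Polarization and closure under conjugation make S a bounded derivation. By the
Singer–Wermer argument every point evaluation kills its range, so S = 0. -/

/-! ### Bounded derivations and characters. -/

section BoundedDerivations

variable {A : Type*} [NormedCommRing A] [NormedAlgebra ℂ A]

/-- Modulo `a ^ (n - k)`, the `k`-th iterate of a derivation maps `a ^ n` to its leading term. -/
theorem Derivation.exists_iterate_pow_eq {R A : Type*} [CommRing R] [CommRing A] [Algebra R A]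
    (d : Derivation R A A) (a : A) (m k : ℕ) :
    ∃ b : A, (d^[k]) (a ^ (m + k)) =
      ((m + k).descFactorial k : A) * (d a) ^ k * a ^ m + b * a ^ (m + 1) := by
  induction k generalizing m with
  | zero => exact ⟨0, by simp⟩
  | succ k ih =>
    obtain ⟨b, hb⟩ := ih (m + 1)
    have hexp : m + (k + 1) = m + 1 + k := by ring
    have hdesc : ((m + 1 + k).descFactorial (k + 1) : A) =
        (m + 1 : A) * ((m + 1 + k).descFactorial k : A) := by
      rw [Nat.descFactorial_succ]
      have : m + 1 + k - k = m + 1 := by omega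
      rw [this]
      push_cast
      ring
    rw [hexp, Function.iterate_succ_apply', hb, hdesc]
    -- Every term in the derivative of the induction formula at `m + 1`, except the leading one,
    -- contains `a ^ (m + 1)`; this is their cofactor.
    refine ⟨((m + 1 + k).descFactorial k : A) * d ((d a) ^ k) + (m + 2) * b * d a + a * d b, ?_⟩
    simp only [map_add, Derivation.leibniz, Derivation.leibniz_pow, smul_eq_mul, nsmul_eq_mul,
      Derivation.map_natCast, mul_zero, add_zero, Nat.add_sub_cancel]
    push_cast
    ring

/-- The Singer–Wermer theorem for a single character: a bounded derivation maps into the kernel of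
every contractive character. -/
theorem Derivation.character_apply_eq_zero (d : Derivation ℂ A A) {C : ℝ}
    (hd : ∀ a, ‖d a‖ ≤ C * ‖a‖) (φ : A →ₐ[ℂ] ℂ) (hφ : ∀ a, ‖φ a‖ ≤ ‖a‖) (a : A) :
    φ (d a) = 0 := by
  by_contra hne
  have hC0 : 0 ≤ C := by
    by_contra! h
    have h1 : 0 < ‖φ (d a)‖ := norm_pos_iff.2 hne
    nlinarith [norm_nonneg a, hφ (d a), hd a]
  -- Centring leaves the derivative unchanged and makes φ kill the remainder in `d^[n] (c ^ n)`,
  -- leaving n! φ(d a)ⁿ against a merely geometric bound.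
  set c : A := a - algebraMap ℂ A (φ a) with hc
  have hφc : φ c = 0 := by simp [hc]
  have hdc : d c = d a := by simp [hc]
  have hiter : ∀ n (x : A), ‖(d^[n]) x‖ ≤ C ^ n * ‖x‖ := by
    intro n x
    induction n with
    | zero => simp
    | succ n ih =>
      rw [Function.iterate_succ_apply', pow_succ']
      calc _ ≤ C * ‖(d^[n]) x‖ := hd _
        _ ≤ C * (C ^ n * ‖x‖) := by gcongr
        _ = _ := by ring
  set r : ℝ := ‖φ (d a)‖ with hr
  have hrpos : 0 < r := norm_pos_iff.2 hne
  have hbound : ∀ n : ℕ, 0 < n → (n.factorial : ℝ) ≤ (C * ‖c‖ / r) ^ n := by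
    intro n hn
    obtain ⟨b, hb⟩ := d.exists_iterate_pow_eq c 0 n
    have h1 : φ ((d^[n]) (c ^ n)) = (n.factorial : ℂ) * φ (d a) ^ n := by
      rw [zero_add] at hb
      rw [hb]
      simp [hφc, hdc, Nat.descFactorial_self]
    have h2 : (n.factorial : ℝ) * r ^ n ≤ C ^ n * ‖c‖ ^ n := by
      calc (n.factorial : ℝ) * r ^ n = ‖φ ((d^[n]) (c ^ n))‖ := by
            rw [h1, norm_mul, norm_pow]; simp [hr]
        _ ≤ ‖(d^[n]) (c ^ n)‖ := hφ _
        _ ≤ C ^ n * ‖c ^ n‖ := hiter _ _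
        _ ≤ C ^ n * ‖c‖ ^ n := by
            gcongr
            exact norm_pow_le' c hn
    rw [div_pow, mul_pow, le_div_iff₀ (by positivity)]
    exact h2
  have hlim := FloorSemiring.tendsto_pow_div_factorial_atTop (C * ‖c‖ / r)
  have hev := (hlim.eventually (gt_mem_nhds (zero_lt_one' ℝ))).and
    (Filter.eventually_gt_atTop 0)
  obtain ⟨n, hn1, hn0⟩ := hev.exists
  have hfac : (0 : ℝ) < n.factorial := by exact_mod_cast n.factorial_pos
  rw [div_lt_one hfac] at hn1
  exact absurd (hbound n hn0) (not_le.2 hn1)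

end BoundedDerivations

/-! ### Hermitian operators and support functionals. -/

section HermitianOperators

/-- A Hermitian operator sends a vector to something of real value under each of its support
functionals. -/
theorem IsHermitianOperator.im_apply_eq_zero {E : Type*} [NormedAddCommGroup E] [NormedSpace ℂ E]
    [CompleteSpace E] {T : E →L[ℂ] E} (hT : IsHermitianOperator T) (φ : E →L[ℂ] ℂ)
    (hφ : ∀ G, ‖φ G‖ ≤ ‖G‖) {F : E} (hF : φ F = ‖F‖) : (φ (T F)).im = 0 := by
  have hexp : HasDerivAt (fun t : ℝ => NormedSpace.exp (t • (Complex.I • T))) (Complex.I • T) 0 := by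
    have := hasDerivAt_exp_smul_const (𝕂 := ℝ) (Complex.I • T) (0 : ℝ)
    simpa using this
  have hre : HasDerivAt
      (fun t : ℝ => (φ ((NormedSpace.exp (t • (Complex.I • T))) F)).re)
      ((φ ((Complex.I • T) F)).re) 0 := by
    let L : (E →L[ℂ] E) →L[ℝ] ℝ := Complex.reCLM.comp
      ((φ.comp (ContinuousLinearMap.apply ℂ E F)).restrictScalars ℝ)
    exact L.hasFDerivAt.comp_hasDerivAt (0 : ℝ) hexp
  -- The value at t = 0 is ‖F‖, which no operator of norm 1 can exceed.
  have hmax : IsLocalMax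
      (fun t : ℝ => (φ ((NormedSpace.exp (t • (Complex.I • T))) F)).re) 0 := by
    refine Filter.Eventually.of_forall fun t => ?_
    have h1 : t • (Complex.I • T) = (Complex.I * (t : ℂ)) • T := by
      rw [← Complex.coe_smul, smul_smul, mul_comm]
    have h2 := hT t
    calc (φ ((NormedSpace.exp (t • (Complex.I • T))) F)).re
        ≤ ‖φ ((NormedSpace.exp (t • (Complex.I • T))) F)‖ := Complex.re_le_norm _
      _ ≤ ‖(NormedSpace.exp (t • (Complex.I • T))) F‖ := hφ _
      _ ≤ ‖NormedSpace.exp (t • (Complex.I • T))‖ * ‖F‖ := ContinuousLinearMap.le_opNorm _ _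
      _ = ‖F‖ := by rw [h1, h2, one_mul]
      _ = _ := by simp [hF]
  have := hmax.hasDerivAt_eq_zero hre
  simpa using this

/-- Multiplication by a Hermitian element is a Hermitian operator. -/
theorem IsHermitianElement.isHermitianOperator_mul {A : Type*} [NormedRing A] [NormedAlgebra ℂ A]
    [CompleteSpace A] (h1 : ‖(1 : A)‖ = 1) {a : A} (ha : IsHermitianElement a) :
    IsHermitianOperator (ContinuousLinearMap.mul ℂ A a) := by
  intro t
  have : NormOneClass A := ⟨h1⟩
  let _ : NormedAlgebra ℚ A := NormedAlgebra.restrictScalars ℚ ℂ A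
  let Φ : A →ₐ[ℂ] (A →L[ℂ] A) :=
    { toFun := fun b => ContinuousLinearMap.mul ℂ A b
      map_one' := by ext; simp
      map_mul' := fun x y => by ext; simp [mul_assoc]
      map_zero' := by simp
      map_add' := fun x y => by simp
      commutes' := fun r => by ext; simp [Algebra.algebraMap_eq_smul_one] }
  have hΦ : Continuous Φ := (ContinuousLinearMap.mul ℂ A).continuous
  have h := NormedSpace.map_exp Φ hΦ ((Complex.I * (t : ℂ)) • a)
  rw [map_smul] at h
  change ‖NormedSpace.exp ((Complex.I * (t : ℂ)) • Φ a)‖ = 1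
  rw [← h]
  change ‖ContinuousLinearMap.mul ℂ A _‖ = 1
  rw [ContinuousLinearMap.opNorm_mul_apply]
  exact ha t

end HermitianOperators

/-! ### Rigidity for the norm ‖F‖∞ + ‖D F‖∞. -/

section SupPlusSeminorm

variable {K : Type*} [TopologicalSpace K] [CompactSpace K]
variable {M : Type*} [TopologicalSpace M] [CompactSpace M]
variable {A : Type*} [NormedCommRing A] [NormedAlgebra ℂ A] [CompleteSpace A]
variable {κ : A →ₐ[ℂ] C(K, ℂ)} {D : A →ₗ[ℂ] C(M, ℂ)}

/-- `IsHermitianOperator.im_apply_eq_zero` for the support functionals `F ↦ α F(p) + ψ(D F)`. -/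
theorem IsHermitianOperator.im_eval_add_eq_zero (hnorm : ∀ F : A, ‖F‖ = ‖κ F‖ + ‖D F‖)
    {T : A →L[ℂ] A} (hT : IsHermitianOperator T) {F : A} {p : K} {α : ℂ} (hα : ‖α‖ ≤ 1)
    (hαF : α * κ F p = ‖κ F‖) {ψ : C(M, ℂ) →L[ℂ] ℂ} (hψ : ‖ψ‖ ≤ 1) (hψF : ψ (D F) = ‖D F‖) :
    (α * κ (T F) p + ψ (D (T F))).im = 0 := by
  let φ₀ : A →ₗ[ℂ] ℂ :=
    { toFun := fun G => α * κ G p + ψ (D G)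
      map_add' := fun x y => by simp; ring
      map_smul' := fun c x => by simp; ring }
  have hφ : ∀ G, ‖φ₀ G‖ ≤ ‖G‖ := by
    intro G
    have h1 : ‖α * κ G p‖ ≤ ‖κ G‖ := by
      rw [norm_mul]
      calc _ ≤ 1 * ‖κ G‖ := by
            gcongr
            exact (κ G).norm_coe_le_norm p
        _ = _ := one_mul _
    have h2 : ‖ψ (D G)‖ ≤ ‖D G‖ := by
      simpa using ψ.le_of_opNorm_le hψ (D G)
    rw [hnorm]
    exact (norm_add_le _ _).trans (add_le_add h1 h2)
  refine hT.im_apply_eq_zero (φ₀.mkContinuous 1 (by simpa using hφ)) hφ (F := F) ?_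
  change α * κ F p + ψ (D F) = ‖F‖
  rw [hαF, hψF, hnorm]
  push_cast
  rfl

/-- A Hermitian operator maps `1` to a real function in the kernel of `D`. -/
theorem IsHermitianOperator.map_one_im_eq_zero (hnorm : ∀ F : A, ‖F‖ = ‖κ F‖ + ‖D F‖)
    (hD1 : D 1 = 0) [Nonempty K] {T : A →L[ℂ] A} (hT : IsHermitianOperator T) :
    (∀ p, (κ (T 1) p).im = 0) ∧ D (T 1) = 0 := by
  obtain ⟨ψ, hψ, hψT⟩ := exists_dual_vector'' ℂ (D (T 1))
  -- Since D 1 = 0, every `c • ψ` is admissible: c = 0 isolates Im (T 1)(p), then c = i isolates ‖D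
  -- (T 1)‖.
  have key : ∀ p (c : ℂ), ‖c‖ ≤ 1 → (κ (T 1) p).im + (c * ‖D (T 1)‖).im = 0 := by
    intro p c hc
    have := hT.im_eval_add_eq_zero hnorm (F := 1) (p := p) (α := 1) (by simp) (by simp)
      (ψ := c • ψ) (by
        rw [norm_smul]
        exact mul_le_one₀ hc (norm_nonneg _) hψ) (by simp [hD1])
    simpa [hψT] using this
  have him : ∀ p, (κ (T 1) p).im = 0 := fun p => by simpa using key p 0 (by simp)
  refine ⟨him, ?_⟩
  have := key (Classical.arbitrary K) Complex.I (by simp)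
  rw [him] at this
  simpa using this

/-- If the difference of two Hermitian operators annihilates `1`, then it maps a real function `F`
to a function vanishing at each point where `|F|` is maximal. -/
theorem IsHermitianOperator.sub_apply_eq_zero_of_isMax
    (hnorm : ∀ F : A, ‖F‖ = ‖κ F‖ + ‖D F‖) (hD1 : D 1 = 0) {T U : A →L[ℂ] A}
    (hT : IsHermitianOperator T) (hU : IsHermitianOperator U) (h1 : (T - U) 1 = 0)
    {F : A} (hF : ∀ q, (κ F q).im = 0) {p : K} (hp : ∀ q, ‖κ F q‖ ≤ ‖κ F p‖)
    (hne : κ F p ≠ 0) : κ ((T - U) F) p = 0 := by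
  obtain ⟨ψ, hψ, hψF⟩ := exists_dual_vector'' ℂ (D F)
  set a : ℝ := (κ F p).re with ha
  have hFp : κ F p = a := Complex.ext (by simp [ha]) (by simp [hF])
  have ha0 : a ≠ 0 := fun h => hne (by rw [hFp, h]; simp)
  have hre : ∀ q, (κ F q).re ^ 2 ≤ a ^ 2 := by
    intro q
    have h := hp q
    have hFq : κ F q = ((κ F q).re : ℂ) := Complex.ext (by simp) (by simp [hF])
    rw [hFp, hFq, Complex.norm_real, Complex.norm_real] at h
    exact sq_le_sq.2 h
  set z : ℂ := κ ((T - U) F) p with hz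
  -- Perturbing `F` by imaginary constants changes the phase at `p` but not `D F`.
  have key : ∀ c : ℝ, ((starRingEnd ℂ (a + c * Complex.I)) * z).im
      + ‖(a + c * Complex.I : ℂ)‖ * (ψ (D ((T - U) F))).im = 0 := by
    intro c
    set w : ℂ := a + c * Complex.I with hw
    have hwre : w.re = a := by simp [hw]
    have hw0 : w ≠ 0 := fun h => ha0 (by rw [← hwre, h]; simp)
    have hwn : (‖w‖ : ℂ) ≠ 0 := by simpa using hw0
    set G : A := F + algebraMap ℂ A (c * Complex.I) with hG
    have hκG : ∀ q, κ G q = κ F q + c * Complex.I := by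
      intro q
      simp [hG]
    have hGp : κ G p = w := by rw [hκG, hFp]
    have hDG : D G = D F := by
      rw [hG, map_add, Algebra.algebraMap_eq_smul_one, map_smul, hD1]
      simp
    have hSG : (T - U) G = (T - U) F := by
      rw [hG, map_add, Algebra.algebraMap_eq_smul_one, map_smul, h1]
      simp
    -- As F is real, |F + ic|² = F² + c², so the maximum stays at p.
    have hGnorm : ‖κ G‖ = ‖w‖ := by
      apply le_antisymm
      · rw [ContinuousMap.norm_le _ (norm_nonneg _)]
        intro q
        rw [hκG, ← sq_le_sq₀ (norm_nonneg _) (norm_nonneg _), ← Complex.normSq_eq_norm_sq,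
          ← Complex.normSq_eq_norm_sq, Complex.normSq_apply, Complex.normSq_apply]
        have := hre q
        simp only [hw, Complex.add_re, Complex.add_im, hF]
        simp
        nlinarith
      · rw [← hGp]
        exact (κ G).norm_coe_le_norm p
    have hα : ‖(starRingEnd ℂ w) / ‖w‖‖ ≤ 1 := by
      rw [norm_div]
      simp [hw0]
    have hαG : (starRingEnd ℂ w) / ‖w‖ * κ G p = ‖κ G‖ := by
      rw [hGp, hGnorm, div_mul_eq_mul_div, div_eq_iff hwn, mul_comm, Complex.mul_conj,
        Complex.normSq_eq_norm_sq]
      push_cast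
      ring
    have e1 := hT.im_eval_add_eq_zero hnorm hα hαG hψ (by rw [hDG, hψF]; rfl)
    have e2 := hU.im_eval_add_eq_zero hnorm hα hαG hψ (by rw [hDG, hψF]; rfl)
    have e3 : ((starRingEnd ℂ w) / ‖w‖ * z + ψ (D ((T - U) F))).im = 0 := by
      rw [hz, ← hSG]
      have : (starRingEnd ℂ w) / ‖w‖ * κ ((T - U) G) p + ψ (D ((T - U) G))
          = ((starRingEnd ℂ w) / ‖w‖ * κ (T G) p + ψ (D (T G)))
            - ((starRingEnd ℂ w) / ‖w‖ * κ (U G) p + ψ (D (U G))) := by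
        simp only [sub_apply, map_sub, ContinuousMap.sub_apply]
        ring
      rw [this, Complex.sub_im, e1, e2, sub_zero]
    have e4 : (starRingEnd ℂ w) * z + ‖w‖ * ψ (D ((T - U) F))
        = (‖w‖ : ℝ) * ((starRingEnd ℂ w) / ‖w‖ * z + ψ (D ((T - U) F))) := by
      field_simp
    have e5 := congrArg Complex.im e4
    rw [Complex.im_ofReal_mul, e3, mul_zero, Complex.add_im, Complex.im_ofReal_mul] at e5
    exact e5
  set k : ℝ := (ψ (D ((T - U) F))).im with hk
  have hpm : ‖(a + (-a : ℝ) * Complex.I : ℂ)‖ = ‖(a + a * Complex.I : ℂ)‖ := by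
    rw [← Complex.norm_conj]
    simp
  -- With z = x + iy, the relation is ay - cx + |a + ic| k = 0. Subtracting c = ±a gives x = 0;
  -- comparing c = a with c = 0 gives k = 0, because √2|a| ≠ |a|; then y = 0.
  have k1 := key a
  have k2 := key (-a)
  have k0 := key 0
  rw [hpm] at k2
  have hsq : ‖(a + a * Complex.I : ℂ)‖ ^ 2 = 2 * a ^ 2 := by
    rw [← Complex.normSq_eq_norm_sq, Complex.normSq_add_mul_I]
    ring
  have hn0 : ‖(a : ℂ)‖ ^ 2 = a ^ 2 := by simp
  set n := ‖(a + a * Complex.I : ℂ)‖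
  simp only [Complex.mul_im, Complex.conj_re, Complex.conj_im] at k0 k1 k2
  simp at k0 k1 k2
  have hzre : z.re = 0 := by
    have : a * z.re = 0 := by linarith
    exact (mul_eq_zero.1 this).resolve_left ha0
  have hk0 : k = 0 := by
    rw [hzre] at k1
    have e1 : a * z.im = - (n * k) := by linarith
    have e2 : a * z.im = - (|a| * k) := by linarith
    have e3 : (n * k) ^ 2 = (|a| * k) ^ 2 := by
      rw [← neg_sq, ← e1, e2, neg_sq]
    rw [mul_pow, mul_pow, hsq, sq_abs] at e3
    have e4 : a ^ 2 * k ^ 2 = 0 := by linarith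
    have := (mul_eq_zero.1 e4).resolve_left (pow_ne_zero 2 ha0)
    exact pow_eq_zero_iff (two_ne_zero) |>.1 this
  have hzim : z.im = 0 := by
    rw [hk0] at k0
    have : a * z.im = 0 := by linarith
    exact (mul_eq_zero.1 this).resolve_left ha0
  exact Complex.ext hzre hzim

/-- If the difference `S` of two Hermitian operators annihilates `1`, then
`S (F ^ 2) = 2 F S F` for real functions `F`. -/
theorem IsHermitianOperator.sub_apply_sq (hκ : Function.Injective κ)
    (hnorm : ∀ F : A, ‖F‖ = ‖κ F‖ + ‖D F‖) (hD1 : D 1 = 0) {T U : A →L[ℂ] A}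
    (hT : IsHermitianOperator T) (hU : IsHermitianOperator U) (h1 : (T - U) 1 = 0)
    {F : A} (hF : ∀ q, (κ F q).im = 0) :
    (T - U) (F * F) = 2 * (F * (T - U) F) := by
  apply hκ
  ext p
  set S := T - U
  set a : ℝ := (κ F p).re with ha
  have hreal : ∀ q, κ F q = ((κ F q).re : ℂ) := fun q => Complex.ext (by simp) (by simp [hF])
  set G : A := F - algebraMap ℂ A a with hG
  have hκG : ∀ q, κ G q = (((κ F q).re - a : ℝ) : ℂ) := by
    intro q
    rw [hG, map_sub, ContinuousMap.sub_apply, hreal q]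
    simp
  -- This makes N - G² positive, so its modulus peaks at p, where G vanishes.
  set N : ℝ := ‖κ G‖ ^ 2 + 1 with hN
  set H : A := algebraMap ℂ A N - G * G with hH
  have hκH : ∀ q, κ H q = ((N - ((κ F q).re - a) ^ 2 : ℝ) : ℂ) := by
    intro q
    rw [hH, map_sub, map_mul, ContinuousMap.sub_apply, ContinuousMap.mul_apply, hκG]
    simp
    ring
  have hHp : κ H p = (N : ℂ) := by rw [hκH]; simp [ha]
  have hNpos : 0 < N := by positivity
  have hSH : κ (S H) p = 0 := by
    refine hT.sub_apply_eq_zero_of_isMax hnorm hD1 hU h1 (fun q => ?_) (fun q => ?_) ?_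
    · rw [hκH, Complex.ofReal_im]
    · have hq : ‖κ G q‖ ≤ ‖κ G‖ := (κ G).norm_coe_le_norm q
      have hq2 : ((κ F q).re - a) ^ 2 ≤ ‖κ G‖ ^ 2 := by
        rw [hκG, Complex.norm_real, Real.norm_eq_abs] at hq
        rw [← sq_abs]
        gcongr
      rw [hHp, hκH, Complex.norm_real, Complex.norm_real, Real.norm_of_nonneg hNpos.le,
        Real.norm_of_nonneg (by rw [hN]; linarith)]
      linarith [sq_nonneg ((κ F q).re - a)]
    · rw [hHp]
      exact_mod_cast hNpos.ne'
  have hHexp : H = ((N : ℂ) - (a : ℂ) * a) • (1 : A) + (2 * (a : ℂ)) • F - F * F := by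
    rw [hH, hG]
    simp only [Algebra.smul_def, map_sub, map_mul, map_ofNat]
    ring
  rw [hHexp, map_sub, map_add, map_smul, map_smul, h1] at hSH
  simp only [smul_zero, zero_add, map_sub, map_smul, ContinuousMap.sub_apply,
    ContinuousMap.smul_apply, smul_eq_mul] at hSH
  have hFp : κ F p = a := hreal p
  rw [two_mul, map_add, ContinuousMap.add_apply, map_mul κ, ContinuousMap.mul_apply, hFp]
  linear_combination -hSH

/-- Two Hermitian operators which agree at `1` are equal. -/
theorem IsHermitianOperator.eq_of_apply_one_eq (hκ : Function.Injective κ)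
    (hconj : ∀ F : A, star (κ F) ∈ κ.range)
    (hnorm : ∀ F : A, ‖F‖ = ‖κ F‖ + ‖D F‖) (hD1 : D 1 = 0) {T U : A →L[ℂ] A}
    (hT : IsHermitianOperator T) (hU : IsHermitianOperator U) (hTU : T 1 = U 1) : T = U := by
  have h1 : (T - U) 1 = 0 := by simp [hTU]
  set S := T - U with hS
  have hsq : ∀ {F : A}, (∀ q, (κ F q).im = 0) → S (F * F) = 2 * (F * S F) :=
    fun hF => hT.sub_apply_sq hκ hnorm hD1 hU h1 hF
  have hmul : ∀ {F G : A}, (∀ q, (κ F q).im = 0) → (∀ q, (κ G q).im = 0) →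
      S (F * G) = F * S G + G * S F := by
    intro F G hF hG
    have hFG := hsq (F := F + G) (fun q => by simp [hF, hG])
    have hexp : (F + G) * (F + G) = F * F + (2 : ℂ) • (F * G) + G * G := by
      rw [two_smul]
      ring
    rw [hexp, map_add, map_add, map_smul, hsq hF, hsq hG, map_add] at hFG
    have h2 : (2 : ℂ) • (S (F * G)) = (2 : ℂ) • (F * S G + G * S F) := by
      simp only [two_smul ℂ] at hFG ⊢
      linear_combination hFG
    have h3 := congrArg (fun x => (2⁻¹ : ℂ) • x) h2
    simpa only [inv_smul_smul₀ (two_ne_zero' ℂ)] using h3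
  have hdecomp : ∀ F : A, ∃ F₁ F₂ : A, (∀ q, (κ F₁ q).im = 0) ∧ (∀ q, (κ F₂ q).im = 0) ∧
      F = F₁ + Complex.I • F₂ := by
    intro F
    obtain ⟨F', hF'⟩ := hconj F
    have hF'q : ∀ q, κ F' q = starRingEnd ℂ (κ F q) := fun q => by
      change κ F' = star (κ F) at hF'
      rw [hF']
      rfl
    refine ⟨(1 / 2 : ℂ) • (F + F'), (-Complex.I / 2) • (F - F'), fun q => ?_, fun q => ?_, ?_⟩
    · rw [map_smul, map_add, ContinuousMap.smul_apply, ContinuousMap.add_apply, hF'q]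
      simp [Complex.mul_im]
    · rw [map_smul, map_sub, ContinuousMap.smul_apply, ContinuousMap.sub_apply, hF'q]
      simp [Complex.mul_im]
    · rw [smul_smul, show Complex.I * (-Complex.I / 2) = 1 / 2 by
        rw [← mul_div_assoc, mul_neg, Complex.I_mul_I, neg_neg], ← smul_add,
        show F + F' + (F - F') = (2 : ℂ) • F by rw [two_smul]; ring, smul_smul]
      norm_num
  -- The Leibniz rule on real functions extends by complex bilinearity.
  let d : Derivation ℂ A A := Derivation.mk' S.toLinearMap (by
    intro F G
    obtain ⟨F₁, F₂, hF₁, hF₂, rfl⟩ := hdecomp F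
    obtain ⟨G₁, G₂, hG₁, hG₂, rfl⟩ := hdecomp G
    change S _ = _ * S _ + _ * S _
    have hexp : (F₁ + Complex.I • F₂) * (G₁ + Complex.I • G₂)
        = F₁ * G₁ + Complex.I • (F₁ * G₂) + Complex.I • (F₂ * G₁)
          + Complex.I • Complex.I • (F₂ * G₂) := by
      simp only [Algebra.smul_def]
      ring
    rw [hexp]
    simp only [map_add, map_smul, hmul hF₁ hG₁, hmul hF₁ hG₂, hmul hF₂ hG₁, hmul hF₂ hG₂]
    simp only [Algebra.smul_def]
    ring)
  have hzero : S = 0 := by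
    ext F
    apply hκ
    ext p
    have := d.character_apply_eq_zero (C := ‖S‖) (fun a => S.le_opNorm a)
      ((ContinuousMap.evalAlgHom ℂ ℂ p).comp κ) (fun a => by
        refine ((κ a).norm_coe_le_norm p).trans ?_
        rw [hnorm]
        exact le_add_of_nonneg_right (norm_nonneg _)) F
    simpa using (show κ (S F) p = 0 from this)
  exact sub_eq_zero.1 hzero

end SupPlusSeminorm

/-! ### Real functions on Y and the characterization. -/

/-- A real function depending on the second variable only is a Hermitian element. -/
theorem isHermitianElement_of_eq_tensorFun_one
    {X Y M A : Type*} [TopologicalSpace X] [CompactSpace X] [TopologicalSpace Y] [CompactSpace Y]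
    [TopologicalSpace M] [CompactSpace M] [Nonempty X] [Nonempty Y]
    [NormedCommRing A] [NormedAlgebra ℂ A] [CompleteSpace A]
    {κ : A →ₐ[ℂ] C(X × Y, ℂ)} {D : A →ₗ[ℂ] C(M, ℂ)}
    (hker : ∀ F : A, F ∈ LinearMap.ker D ↔ ∃ g : C(Y, ℂ), κ F = tensorFun 1 g)
    (hnorm : ∀ F : A, ‖F‖ = ‖κ F‖ + ‖D F‖) {a : A} {g : C(Y, ℂ)} (ha : κ a = tensorFun 1 g)
    (hreal : ∀ y, (g y).im = 0) : IsHermitianElement a := by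
  intro t
  let _ : NormedAlgebra ℚ A := NormedAlgebra.restrictScalars ℚ ℂ A
  have hκ : Continuous κ := by
    refine AddMonoidHomClass.continuous_of_bound κ 1 fun F => ?_
    rw [one_mul, hnorm]
    exact le_add_of_nonneg_right (norm_nonneg _)
  have hexp : ∀ p, κ (NormedSpace.exp ((Complex.I * (t : ℂ)) • a)) p
      = Complex.exp (Complex.I * t * g p.2) := by
    intro p
    have hev : Continuous ((ContinuousMap.evalAlgHom ℂ ℂ p).comp κ) :=
      (continuous_eval_const p).comp hκ
    have := NormedSpace.map_exp ((ContinuousMap.evalAlgHom ℂ ℂ p).comp κ) hev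
      ((Complex.I * (t : ℂ)) • a)
    rw [map_smul] at this
    have hap : (ContinuousMap.evalAlgHom ℂ ℂ p).comp κ a = g p.2 := by
      change κ a p = g p.2
      rw [ha]
      simp [tensorFun]
    rw [hap, ← Complex.exp_eq_exp_ℂ] at this
    exact this
  -- The exponential still depends on y alone, so only its supremum norm counts.
  have hD : D (NormedSpace.exp ((Complex.I * (t : ℂ)) • a)) = 0 := by
    rw [← LinearMap.mem_ker, hker]
    refine ⟨⟨fun y => Complex.exp (Complex.I * t * g y), by fun_prop⟩, ?_⟩
    ext p
    rw [hexp]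
    simp [tensorFun]
  have hone : ∀ p, ‖κ (NormedSpace.exp ((Complex.I * (t : ℂ)) • a)) p‖ = 1 := by
    intro p
    rw [hexp, Complex.norm_exp]
    simp [Complex.mul_re, hreal]
  rw [hnorm, hD, norm_zero, add_zero]
  apply le_antisymm
  · exact (ContinuousMap.norm_le _ zero_le_one).2 fun p => (hone p).le
  · rw [← hone (Classical.arbitrary (X × Y))]
    exact ContinuousMap.norm_coe_le_norm _ _

theorem proposition7p3
    {X : Type u} [TopologicalSpace X] [CompactSpace X] [T2Space X]
    {Y : Type v} [TopologicalSpace Y] [CompactSpace Y] [T2Space Y]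
    {B : Type u₁} [NormedCommRing B] [NormedAlgebra ℂ B] [CompleteSpace B]
    {Bt : Type u₂} [NormedCommRing Bt] [NormedAlgebra ℂ Bt] [CompleteSpace Bt]
    (ι : B →ₐ[ℂ] C(X, ℂ)) (κ : Bt →ₐ[ℂ] C(X × Y, ℂ))
    (h : IsNaturalValuezation.{u, v, w, u₁, u₂} ι κ)
    (T : Bt →L[ℂ] Bt) :
    IsHermitianOperator T ↔
      (IsHermitianElement (T 1) ∧ T = ContinuousLinearMap.mul ℂ Bt (T 1)) := by
  obtain ⟨M, _, _, _, D, hker, -, hnorm⟩ := h.exists_map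
  have hκ := h.subalgebra.injective
  rcases isEmpty_or_nonempty (X × Y) with hXY | hXY
  -- In the zero algebra exponentials have norm 0, so both sides are false.
  · have hsub : Subsingleton Bt :=
      ⟨fun a b => hκ (ContinuousMap.ext fun p => hXY.elim p)⟩
    constructor
    · intro hT
      have := hT 0
      rw [Subsingleton.elim (NormedSpace.exp _ : Bt →L[ℂ] Bt) 0, norm_zero] at this
      exact absurd this zero_ne_one
    · rintro ⟨hT, -⟩
      have := hT 0
      rw [Subsingleton.elim (NormedSpace.exp _ : Bt) 0, norm_zero] at this
      exact absurd this zero_ne_one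
  have hX : Nonempty X := ⟨(Classical.arbitrary (X × Y)).1⟩
  have hY : Nonempty Y := ⟨(Classical.arbitrary (X × Y)).2⟩
  have hD1 : D 1 = 0 := by
    rw [← LinearMap.mem_ker, hker]
    exact ⟨1, by ext p; simp [tensorFun]⟩
  have hone : ‖(1 : Bt)‖ = 1 := by rw [hnorm, hD1]; simp
  constructor
  · intro hT
    obtain ⟨him, hDT⟩ := hT.map_one_im_eq_zero hnorm hD1
    obtain ⟨g, hg⟩ := (hker (T 1)).1 (LinearMap.mem_ker.2 hDT)
    have hgreal : ∀ y, (g y).im = 0 := fun y => by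
      have := him (Classical.arbitrary X, y)
      rw [hg] at this
      simpa [tensorFun] using this
    have hH := isHermitianElement_of_eq_tensorFun_one hker hnorm hg hgreal
    exact ⟨hH, hT.eq_of_apply_one_eq hκ h.selfAdjoint.conj_mem hnorm hD1
      (hH.isHermitianOperator_mul hone) (by simp)⟩
  · rintro ⟨hH, hT⟩
    rw [hT]
    exact hH.isHermitianOperator_mul hone
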